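/- **Setting.** There are $k$ slots with click-through rates $\theta_1>\theta_2>\dots>\theta_k>0$ and $n\ge k$ players. Player $i$ has a value per click $v_i\ge 0$ and a budget $B_i\ge 0$; the budgets $B_1,\dots,B_n$ are pairwise distinct. An assignment gives each player at most one slot, and gives a player $i$ with a slot $s(i)$ a price per click $p(i)$. The utility $u_i$ of player $i$ is $0$ if he gets no slot, $\theta_{s(i)}(v_i-p(i))$ if he gets slot $s(i)$ and $\theta_{s(i)}p(i)\le B_i$, and $-\infty$ if he gets slot $s(i)$ and $\theta_{s(i)}p(i)>B_i$. An assignment is *envy-free* if every slot is given to exactly one player and, for all players $i$ and all players $i'$ holding a slot, $u_i\ge\max\{\theta_{s(i')}(v_i-p(i')),0\}$ if $\theta_{s(i')}p(i')\le B_i$, and $u_i\ge 0$ otherwise. **Mechanism.** In the Best Offer Budget-Conscious second-price auction (BCBO), each player $i$ submits a value-bid $b_i\ge0$ and a budget-bid $g_i\ge0$, which need not be his true value and budget. The slots $1,2,\dots,k$ are awarded in this order. Slot $s$ goes to the unassigned player with the largest offer $\min\{b_i,\,g_i/\theta_s\}$, ties being broken by a fixed a priori ordering of the players, and his price per click is the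 largest offer for slot $s$ among the other players unassigned at that moment ($0$ if there are none). Players without a slot pay nothing. A bid profile $(b_i,g_i)_{i}$ is a *Nash equilibrium* if no player can increase his utility by changing his own pair $(b_i,g_i)$ to another pair of nonnegative numbers. **Theorem.** In every such setting, and for every tie-breaking order, the Best Offer Budget-Conscious second-price auction has a Nash equilibrium whose outcome (slots and prices) is an envy-free assignment. -/

import Mathlib

namespace BudgetAuction

/-- A bid of a player: a value-bid (the most he declares to pay per click) and a budget-bid
(the total budget he declares); both are nonnegative amounts of money. -/
structure Bid where
  value : ℝ
  budget : ℝ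
  value_nonneg : 0 ≤ value
  budget_nonneg : 0 ≤ budget

/-- The data of a position auction with `n` players and `k` slots. Slot `0` is the highest slot.
`tie` is the a priori ordering of the players: in a tie the player with the smaller rank wins. -/
structure Setting (n k : ℕ) where
  ctr : Fin k → ℝ
  value : Fin n → ℝ
  budget : Fin n → ℝ
  tie : Equiv.Perm (Fin n)

/-- The standing assumptions: there are at least as many players as slots, the click-through rates
are positive and strictly decreasing, values and budgets are nonnegative, and the budgets are
pairwise distinct. -/
structure Setting.IsAdmissible {n k : ℕ} (S : Setting n k) : Prop where
  slots_le_players : k ≤ n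
  ctr_pos : ∀ j, 0 < S.ctr j
  ctr_strictAnti : StrictAnti S.ctr
  value_nonneg : ∀ i, 0 ≤ S.value i
  budget_nonneg : ∀ i, 0 ≤ S.budget i
  budget_injective : Function.Injective S.budget

/-- A slot allocation together with a price per click for each player. `slot i = none` means that
player `i` gets no slot (his price is then irrelevant). -/
structure Assignment (n k : ℕ) where
  slot : Fin n → Option (Fin k)
  price : Fin n → ℝ

/-- The utility of player `i`: zero without a slot, `θ (v - p)` if his (true) budget
constraint `θ p ≤ B` holds, and `-∞` if it is violated. -/
noncomputable def utility {n k : ℕ} (S : Setting n k) (a : Assignment n k) (i : Fin n) : EReal :=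
  match a.slot i with
  | none => 0
  | some j =>
    if S.ctr j * a.price i ≤ S.budget i then
      ((S.ctr j * (S.value i - a.price i) : ℝ) : EReal)
    else ⊥

/-- Envy-free assignments: every slot is given to exactly one player, and no player would get a
larger utility from no slot or from the slot and price of another player, if he can afford it. -/
structure IsEnvyFree {n k : ℕ} (S : Setting n k) (a : Assignment n k) : Prop where
  slot_unique : ∀ i i' j, a.slot i = some j → a.slot i' = some j → i = i'
  slot_assigned : ∀ j, ∃ i, a.slot i = some j
  no_envy : ∀ i i' j, a.slot i' = some j →
    (if S.ctr j * a.price i' ≤ S.budget i then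
      ((max (S.ctr j * (S.value i - a.price i')) 0 : ℝ) : EReal)
    else 0) ≤ utility S a i

/-! ### The best offer budget-conscious second-price auction -/

/-- The amount per click `min {b, g / θ}` that a bid offers for a slot with
click-through rate `θ`. -/
noncomputable def offer (b : Bid) (θ : ℝ) : ℝ := min b.value (b.budget / θ)

/-- Player `i` has priority over player `i'` for slot `j`: he offers more, or the same amount and
is favoured by the tie-breaking order. -/
def Beats {n k : ℕ} (S : Setting n k) (β : Fin n → Bid) (j : Fin k) (i i' : Fin n) : Prop :=
  offer (β i') (S.ctr j) < offer (β i) (S.ctr j) ∨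
    (offer (β i') (S.ctr j) = offer (β i) (S.ctr j) ∧ S.tie i < S.tie i')

/-- Among the players in `U`, player `i` makes the best offer for slot `j`. -/
def IsBest {n k : ℕ} (S : Setting n k) (β : Fin n → Bid) (j : Fin k) (U : Finset (Fin n))
    (i : Fin n) : Prop :=
  i ∈ U ∧ ∀ i' ∈ U, i' ≠ i → Beats S β j i i'

theorem existsUnique_isBest {n k : ℕ} (S : Setting n k) (β : Fin n → Bid) (j : Fin k)
    (U : Finset (Fin n)) (hU : U.Nonempty) : ∃! i, IsBest S β j U i := by
  obtain ⟨m, hm, hmax⟩ := U.exists_max_image (fun i => offer (β i) (S.ctr j)) hU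
  obtain ⟨w, hw, hmin⟩ := (U.filter (fun i => offer (β m) (S.ctr j) = offer (β i) (S.ctr j))
    ).exists_min_image S.tie ⟨m, by simp [hm]⟩
  simp only [Finset.mem_filter] at hw hmin
  refine ⟨w, ⟨hw.1, fun i' hi' hne => ?_⟩, fun y hy => ?_⟩
  · rcases (hmax i' hi').lt_or_eq with h | h
    · exact Or.inl (hw.2 ▸ h)
    · refine Or.inr ⟨h.trans hw.2, lt_of_le_of_ne (hmin i' ⟨hi', h.symm⟩) ?_⟩
      exact fun e => hne (S.tie.injective e.symm)
  · by_contra hne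
    rcases hy.2 w hw.1 (Ne.symm hne) with h | h
    · exact absurd (hmax y hy.1) (not_le.mpr (hw.2 ▸ h))
    · exact absurd (hmin y ⟨hy.1, hw.2.trans h.1⟩) (not_le.mpr h.2)

open Classical in
/-- The players that are still unassigned when the `m` highest slots have been awarded. -/
noncomputable def unassigned {n k : ℕ} (S : Setting n k) (β : Fin n → Bid) : ℕ → Finset (Fin n)
  | 0 => Finset.univ
  | m + 1 =>
    if h : m < k then
      (unassigned S β m).filter (fun i => ¬ IsBest S β ⟨m, h⟩ (unassigned S β m) i)
    else unassigned S β m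

/-- Slot `j` is awarded to player `i`: he makes the best offer for it among the players that did
not get a higher slot. -/
def Wins {n k : ℕ} (S : Setting n k) (β : Fin n → Bid) (j : Fin k) (i : Fin n) : Prop :=
  IsBest S β j (unassigned S β j) i

open Classical in
/-- The slot that player `i` gets, if any. -/
noncomputable def slotOf {n k : ℕ} (S : Setting n k) (β : Fin n → Bid) (i : Fin n) :
    Option (Fin k) :=
  if h : ∃ j, Wins S β j i then some h.choose else none

/-- The price per click that player `i` pays if he is awarded slot `j`: the largest offer for `j`
among the other players unassigned at that moment, and zero if there is none. -/
noncomputable def priceAt {n k : ℕ} (S : Setting n k) (β : Fin n → Bid) (j : Fin k) (i : Fin n) :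
    ℝ :=
  if h : ((unassigned S β j).erase i).Nonempty then
    ((unassigned S β j).erase i).sup' h (fun i' => offer (β i') (S.ctr j))
  else 0

/-- The outcome of the best offer budget-conscious mechanism on the bid profile `β`. Players
without a slot pay nothing. -/
noncomputable def outcome {n k : ℕ} (S : Setting n k) (β : Fin n → Bid) : Assignment n k where
  slot := slotOf S β
  price i :=
    match slotOf S β i with
    | none => 0
    | some j => priceAt S β j i

/-- A bid profile is a (pure) Nash equilibrium of the mechanism if no player can increase his
utility by changing his value-bid and budget-bid. -/
def IsNash {n k : ℕ} (S : Setting n k) (β : Fin n → Bid) : Prop :=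
  ∀ (i : Fin n) (b : Bid),
    utility S (outcome S (Function.update β i b)) i ≤ utility S (outcome S β) i

end BudgetAuction

/-! Pad the slots with worthless ones until there are as many slots as players, and look for total
prices `q` and a matching that form an envy-free outcome (`IsPriceEq`). Given these, let the player
of rank `t` submit the price of the slot above his as budget-bid. Everyone then pays the price of
his own slot, and a deviator who gets slot `j` pays at least the price of `j`, so absence of envy
already makes the profile a Nash equilibrium (`isNash_of_sorted`).

Envy-freeness must hold also for a slot that costs exactly the player's budget, which is not a
closed condition. Exempting that boundary case gives the closed notion `IsApproxEq` with error 0; it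
is attained as a limit of deferred acceptance with price step `δ` (`exists_isApproxEq_zero`).

To remove the exemption, budgets are raised slightly, `B i` to `B i + ε i`, with larger raises for
smaller budgets. Absence of envy is then immediate for the true budgets; what may fail is that
players can still pay. In a least equilibrium every price is explained by a chain of indifferences
that starts at price zero or at the raised budget of an envious player (`IsLeastEq.exists_root`),
and the chain differences lie in a finite set independent of budgets. For small raises, a price
between `B l` and `B l + ε l` must therefore come from a player `i` with `ε i ≤ ε l`. The chain
never leads below its starting slot (`IsLeastEq.le_of_path`), which forces `B i = B l`; distinctness
of the budgets gives `i = l`, a contradiction. -/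

namespace BudgetAuction

/-! ### Existence of equilibria with the budget boundary exempted -/

variable {α τ : Type*}

/-- `q` is a vector of total prices of the slots and `π` a matching of players and slots such that
no player exceeds his budget `b`, and, up to an error `δ`, no player prefers a slot whose price is
strictly within his budget. -/
structure IsApproxEq (θ : τ → ℝ) (v b : α → ℝ) (δ : ℝ) (π : α ≃ τ) (q : τ → ℝ) : Prop where
  nonneg : ∀ t, 0 ≤ q t
  exists_zero : ∃ t, q t = 0
  afford : ∀ i, q (π i) ≤ b i
  no_envy : ∀ i t, b i ≤ q t + δ ∨ θ t * v i - (q t + δ) ≤ θ (π i) * v i - q (π i)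

theorem IsApproxEq.mono {θ : τ → ℝ} {v b : α → ℝ} {δ δ' : ℝ} {π : α ≃ τ} {q : τ → ℝ}
    (h : IsApproxEq θ v b δ π q) (hδ : δ ≤ δ') : IsApproxEq θ v b δ' π q :=
  ⟨h.nonneg, h.exists_zero, h.afford, fun i t => (h.no_envy i t).imp (fun h => by linarith)
    (fun h => by linarith)⟩

/-- The states of the deferred acceptance procedure in which prices are multiples of `δ`:
`σ t` is the player who holds slot `t` at the price `p t * δ`. -/
structure IsTentative (θ : τ → ℝ) (v b : α → ℝ) (δ : ℝ) (σ : τ → Option α) (p : τ → ℕ) :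
    Prop where
  inj : ∀ s t i, σ s = some i → σ t = some i → s = t
  price_of_none : ∀ t, σ t = none → p t = 0
  exists_zero : ∃ t, p t = 0
  afford : ∀ t i, σ t = some i → p t * δ ≤ b i
  no_envy : ∀ s i, σ s = some i → ∀ t,
    b i ≤ p t * δ + δ ∨ θ t * v i - (p t * δ + δ) ≤ θ s * v i - p s * δ

theorem isClosed_isApproxEq [Finite τ] (θ : τ → ℝ) (v b : α → ℝ) (δ : ℝ) (π : α ≃ τ) :
    IsClosed {q | IsApproxEq θ v b δ π q} := by
  have : {q | IsApproxEq θ v b δ π q} = (⋂ t, {q | 0 ≤ q t}) ∩ ((⋃ t, {q | q t = 0}) ∩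
      ((⋂ i, {q | q (π i) ≤ b i}) ∩ ⋂ i, ⋂ t, ({q | b i ≤ q t + δ} ∪
        {q | θ t * v i - (q t + δ) ≤ θ (π i) * v i - q (π i)}))) := by
    ext q
    simp only [Set.mem_ofPred_eq, Set.mem_inter_iff, Set.mem_iInter, Set.mem_iUnion, Set.mem_union]
    exact ⟨fun h => ⟨h.1, h.2, h.3, h.4⟩, fun h => ⟨h.1, h.2.1, h.2.2.1, h.2.2.2⟩⟩
  rw [this]
  refine (isClosed_iInter fun t => isClosed_le (by fun_prop) (by fun_prop)).inter
    ((isClosed_iUnion_of_finite fun t => isClosed_eq (by fun_prop) (by fun_prop)).inter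
    ((isClosed_iInter fun t => isClosed_le (by fun_prop) (by fun_prop)).inter
    (isClosed_iInter fun i => isClosed_iInter fun t => (isClosed_le (by fun_prop)
      (by fun_prop)).union (isClosed_le (by fun_prop) (by fun_prop)))))

theorem isCompact_isApproxEq [Finite τ] (θ : τ → ℝ) (v b : α → ℝ) (δ : ℝ) (π : α ≃ τ) :
    IsCompact {q | IsApproxEq θ v b δ π q} := by
  refine (isCompact_Icc (a := (0 : τ → ℝ)) (b := fun t => b (π.symm t))).of_isClosed_subset
    (isClosed_isApproxEq θ v b δ π) fun q h => ⟨fun t => h.nonneg t, fun t => ?_⟩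
  simpa using h.afford (π.symm t)

variable [Fintype α] [Fintype τ]

theorem exists_eq_none_of_unmatched (hcard : Fintype.card α = Fintype.card τ)
    {σ : τ → Option α} (inj : ∀ s t i, σ s = some i → σ t = some i → s = t) {i : α}
    (hi : ∀ t, σ t ≠ some i) : ∃ t, σ t = none := by
  classical
  by_contra! hcon
  have hs : ∀ t, ∃ j, σ t = some j := fun t => Option.ne_none_iff_exists'.mp (hcon t)
  choose f hf using hs
  have hinj : Function.Injective f := fun s t hst => inj s t (f s) (hf s) (by rw [hst]; exact hf t)
  have hb := (Fintype.bijective_iff_injective_and_card f).2 ⟨hinj, hcard.symm⟩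
  obtain ⟨t, ht⟩ := hb.2 i
  exact hi t (ht ▸ hf t)

/-- An unmatched player takes his favourite affordable slot, displacing its holder if there is one.
The displayed sum is a potential: it grows by one whether an empty slot is filled or a held one is
outbid. -/
theorem IsTentative.step [DecidableEq τ] {θ : τ → ℝ} {v b : α → ℝ} {δ : ℝ} (hδ : 0 < δ)
    (hb : ∀ i, 0 ≤ b i) (hcard : Fintype.card α = Fintype.card τ)
    {σ : τ → Option α} {p : τ → ℕ} (h : IsTentative θ v b δ σ p) {i : α}
    (hi : ∀ t, σ t ≠ some i) :
    ∃ σ' p', IsTentative θ v b δ σ' p' ∧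
      ∑ t, (p' t + if σ' t = none then 0 else 1) =
        ∑ t, (p t + if σ t = none then 0 else 1) + 1 := by
  obtain ⟨t₀, ht₀⟩ := exists_eq_none_of_unmatched hcard h.inj hi
  -- The asking prices: an empty slot costs nothing, a held one costs one increment more. The empty
  -- slot `t₀` ensures that something is affordable.
  set p₁ : τ → ℕ := fun t => if σ t = none then 0 else p t + 1 with hp₁
  obtain ⟨t, ht, hmax⟩ := (Finset.univ.filter (fun t => (p₁ t : ℝ) * δ ≤ b i)).exists_max_image
    (fun t => θ t * v i - p₁ t * δ) ⟨t₀, by simp [hp₁, ht₀, hb i]⟩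
  simp only [Finset.mem_filter, Finset.mem_univ, true_and] at ht hmax
  have hle : ∀ s, p₁ s ≤ p s + 1 := fun s => by simp only [hp₁]; split_ifs <;> omega
  have hge : ∀ s, p s ≤ p₁ s := fun s => by
    simp only [hp₁]; split_ifs with hs
    · rw [h.price_of_none s hs]
    · omega
  have hge' : ∀ s, p s ≤ Function.update p t (p₁ t) s := fun s => by
    by_cases hs : s = t
    · subst hs; simpa using hge s
    · simp [hs]
  refine ⟨Function.update σ t (some i), Function.update p t (p₁ t), ⟨?_, ?_, ?_, ?_, ?_⟩, ?_⟩
  · intro s s' j hs hs'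
    by_cases h1 : s = t <;> by_cases h2 : s' = t
    · rw [h1, h2]
    · subst h1
      rw [Function.update_self] at hs
      rw [Function.update_of_ne h2] at hs'
      exact absurd (hs'.trans hs.symm) (hi s')
    · subst h2
      rw [Function.update_self] at hs'
      rw [Function.update_of_ne h1] at hs
      exact absurd (hs.trans hs'.symm) (hi s)
    · rw [Function.update_of_ne h1] at hs
      rw [Function.update_of_ne h2] at hs'
      exact h.inj s s' j hs hs'
  · intro s hs
    by_cases h1 : s = t
    · subst h1; simp at hs
    · rw [Function.update_of_ne h1] at hs ⊢
      exact h.price_of_none s hs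
  · by_cases hσ : σ t = none
    · exact ⟨t, by simp [hp₁, hσ]⟩
    · refine ⟨t₀, ?_⟩
      have : t₀ ≠ t := fun e => hσ (e ▸ ht₀)
      rw [Function.update_of_ne this]
      exact h.price_of_none _ ht₀
  · intro s j hs
    by_cases h1 : s = t
    · subst h1
      rw [Function.update_self] at hs ⊢
      cases hs
      exact ht
    · rw [Function.update_of_ne h1] at hs ⊢
      exact h.afford s j hs
  · intro s j hs s'
    have hc : (p s' : ℝ) * δ ≤ (Function.update p t (p₁ t) s' : ℕ) * δ := by
      have := hge' s'
      gcongr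
    by_cases h1 : s = t
    · subst h1
      rw [Function.update_self] at hs
      cases hs
      rw [Function.update_self]
      have hc' : (p₁ s' : ℝ) * δ ≤ (p s' : ℝ) * δ + δ := by
        have : (p₁ s' : ℝ) ≤ p s' + 1 := by exact_mod_cast hle s'
        nlinarith
      by_cases hs' : (p₁ s' : ℝ) * δ ≤ b i
      · right
        have := hmax s' hs'
        linarith
      · left; linarith
    · rw [Function.update_of_ne h1] at hs ⊢
      rcases h.no_envy s j hs s' with h2 | h2
      · left; linarith
      · right; linarith
  · rw [← Finset.add_sum_erase _ _ (Finset.mem_univ t),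
      ← Finset.add_sum_erase Finset.univ (fun t => p t + if σ t = none then 0 else 1)
        (Finset.mem_univ t)]
    have : ∑ x ∈ Finset.univ.erase t, (Function.update p t (p₁ t) x +
        if Function.update σ t (some i) x = none then 0 else 1) =
        ∑ x ∈ Finset.univ.erase t, (p x + if σ x = none then 0 else 1) := by
      refine Finset.sum_congr rfl fun x hx => ?_
      rw [Function.update_of_ne (Finset.ne_of_mem_erase hx),
        Function.update_of_ne (Finset.ne_of_mem_erase hx)]
    rw [this]
    simp only [Function.update_self, hp₁, reduceCtorEq, if_false]
    split_ifs with hσ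
    · rw [h.price_of_none t hσ]; omega
    · omega

/-- The procedure must end with everybody matched: otherwise the potential would grow forever, while
the budgets bound every price. -/
theorem exists_isApproxEq_of_pos [Nonempty τ] {θ : τ → ℝ} {v b : α → ℝ} {δ : ℝ} (hδ : 0 < δ)
    (hb : ∀ i, 0 ≤ b i) (hcard : Fintype.card α = Fintype.card τ) :
    ∃ π q, IsApproxEq θ v b δ π q := by
  classical
  by_cases hcon : ∃ σ p, IsTentative θ v b δ σ p ∧ ∀ i, ∃ t, σ t = some i
  · obtain ⟨σ, p, h, hall⟩ := hcon
    choose f hf using hall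
    have hinj : Function.Injective f := fun i j hij => by
      have h1 := hf i
      rw [hij, hf j] at h1
      exact (Option.some_injective _ h1).symm
    have hbij := (Fintype.bijective_iff_injective_and_card f).2 ⟨hinj, hcard⟩
    obtain ⟨t, ht⟩ := h.exists_zero
    exact ⟨Equiv.ofBijective f hbij, fun t => p t * δ, fun t => by positivity,
      ⟨t, by simp [ht]⟩, fun i => h.afford _ i (hf i), fun i t => h.no_envy _ i (hf i) t⟩
  · push Not at hcon
    exfalso
    have key : ∀ N : ℕ, ∃ σ p, IsTentative θ v b δ σ p ∧
        ∑ t, (p t + if σ t = none then 0 else 1) = N := by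
      intro N
      induction N with
      | zero =>
        refine ⟨fun _ => none, fun _ => 0, ⟨by simp, by simp, ⟨Classical.arbitrary τ, rfl⟩,
          by simp, by simp⟩, by simp⟩
      | succ N ih =>
        obtain ⟨σ, p, h, hN⟩ := ih
        obtain ⟨i, hi⟩ := hcon σ p h
        obtain ⟨σ', p', h', hN'⟩ := h.step hδ hb hcard hi
        exact ⟨σ', p', h', by rw [hN', hN]⟩
    obtain ⟨M, hM⟩ := exists_nat_gt ((∑ i, b i) / δ)
    have hbM : ∀ i, b i < M * δ := fun i => by
      rw [div_lt_iff₀ hδ] at hM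
      exact (Finset.single_le_sum (fun j _ => hb j) (Finset.mem_univ i)).trans_lt hM
    obtain ⟨σ, p, h, hN⟩ := key (Fintype.card τ * (M + 1) + 1)
    have : ∑ t, (p t + if σ t = none then 0 else 1) ≤ ∑ _t : τ, (M + 1) := by
      refine Finset.sum_le_sum fun t _ => ?_
      rcases hσ : σ t with _ | i
      · simp [h.price_of_none t hσ]
      · have h1 : (p t : ℝ) * δ < M * δ := (h.afford t i hσ).trans_lt (hbM i)
        have h2 : (p t : ℝ) < M := lt_of_mul_lt_mul_right h1 hδ.le
        have h3 : p t < M := by exact_mod_cast h2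
        simp; omega
    simp at this
    omega

/-- There are finitely many matchings, so a single one serves errors tending to zero; its price
vectors form nested nonempty compact sets. -/
theorem exists_isApproxEq_zero [Nonempty τ] {θ : τ → ℝ} {v b : α → ℝ}
    (hb : ∀ i, 0 ≤ b i) (hcard : Fintype.card α = Fintype.card τ) :
    ∃ π q, IsApproxEq θ v b 0 π q := by
  classical
  have hmono : ∀ m m' : ℕ, m ≤ m' → 1 / ((m' : ℝ) + 1) ≤ 1 / ((m : ℝ) + 1) :=
    fun m m' h => Nat.one_div_le_one_div h
  obtain ⟨π, hπ⟩ : ∃ π : α ≃ τ, ∀ m : ℕ,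
      {q | IsApproxEq θ v b (1 / ((m : ℝ) + 1)) π q}.Nonempty := by
    by_contra! hcon
    choose f hf using hcon
    -- `f π` is an index at which `π` fails; the sum of all of them is an index at which every
    -- matching fails.
    obtain ⟨π, q, h⟩ := exists_isApproxEq_of_pos (θ := θ) (v := v)
      (δ := 1 / (((∑ π, f π : ℕ) : ℝ) + 1)) (by positivity) hb hcard
    have := h.mono (hmono _ _ (Finset.single_le_sum (fun _ _ => Nat.zero_le _)
      (Finset.mem_univ π)))
    exact (Set.eq_empty_iff_forall_notMem.1 (hf π)) q this
  obtain ⟨q, hq⟩ := IsCompact.nonempty_iInter_of_sequence_nonempty_isCompact_isClosed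
    (fun m : ℕ => {q | IsApproxEq θ v b (1 / ((m : ℝ) + 1)) π q})
    (fun m q h => h.mono (hmono m (m + 1) (Nat.le_succ m))) hπ
    (isCompact_isApproxEq _ _ _ _ _) (fun m => isClosed_isApproxEq _ _ _ _ _)
  simp only [Set.mem_iInter, Set.mem_ofPred_eq] at hq
  refine ⟨π, q, (hq 0).nonneg, (hq 0).exists_zero, (hq 0).afford, fun i t => ?_⟩
  by_contra! hcon
  obtain ⟨m, hm⟩ := exists_nat_one_div_lt (lt_min (sub_pos.2 hcon.1) (sub_pos.2 hcon.2))
  rw [lt_min_iff] at hm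
  rcases (hq m).no_envy i t with h | h <;> linarith [hm.1, hm.2]

/-- An equilibrium with the least sum of prices and, for its prices, a matching with the largest
total value. -/
structure IsLeastEq (θ : τ → ℝ) (v b : α → ℝ) (π : α ≃ τ) (q : τ → ℝ) : Prop where
  isEq : IsApproxEq θ v b 0 π q
  sum_le : ∀ π' q', IsApproxEq θ v b 0 π' q' → ∑ t, q t ≤ ∑ t, q' t
  le_sum : ∀ π', IsApproxEq θ v b 0 π' q → ∑ i, θ (π' i) * v i ≤ ∑ i, θ (π i) * v i

theorem exists_isLeastEq [Nonempty τ] {θ : τ → ℝ} {v b : α → ℝ}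
    (hb : ∀ i, 0 ≤ b i) (hcard : Fintype.card α = Fintype.card τ) :
    ∃ π q, IsLeastEq θ v b π q := by
  classical
  have hc : IsCompact (⋃ π, {q | IsApproxEq θ v b 0 π q}) :=
    isCompact_iUnion fun π => isCompact_isApproxEq θ v b 0 π
  obtain ⟨π₀, q₀, h₀⟩ := exists_isApproxEq_zero (θ := θ) (v := v) hb hcard
  obtain ⟨q, hq, hmin⟩ := hc.exists_isMinOn ⟨q₀, Set.mem_iUnion.2 ⟨π₀, h₀⟩⟩
    (f := fun q => ∑ t, q t) (by fun_prop)
  obtain ⟨π₁, h₁⟩ := Set.mem_iUnion.1 hq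
  obtain ⟨π, hπ, hmax⟩ := Set.exists_max_image {π | IsApproxEq θ v b 0 π q}
    (fun π => ∑ i, θ (π i) * v i) (Set.toFinite _) ⟨π₁, h₁⟩
  exact ⟨π, q, hπ, fun π' q' h' => hmin (Set.mem_iUnion.2 ⟨π', h'⟩), fun π' h' => hmax π' h'⟩

end BudgetAuction

/-! ### Supporting chains in least equilibria -/

namespace BudgetAuction

theorem _root_.Set.Finite.exists_pos_le {F : Set ℝ} (hF : F.Finite) :
    ∃ δ > 0, ∀ x ∈ F, 0 < x → δ ≤ x := by
  induction F, hF using Set.Finite.induction_on with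
  | empty => exact ⟨1, one_pos, by simp⟩
  | @insert a F _ _ ih =>
    obtain ⟨δ, hδ, h⟩ := ih
    by_cases ha : 0 < a
    · refine ⟨min a δ, lt_min ha hδ, ?_⟩
      rintro x (rfl | hx) h0
      · exact min_le_left _ _
      · exact (min_le_right _ _).trans (h x hx h0)
    · refine ⟨δ, hδ, ?_⟩
      rintro x (rfl | hx) h0
      · exact absurd h0 ha
      · exact h x hx h0

theorem _root_.Relation.ReflTransGen.avoid_target {β : Type*} {R : β → β → Prop} {x y : β}
    (h : Relation.ReflTransGen R x y) : Relation.ReflTransGen (fun a c => a ≠ y ∧ R a c) x y := by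
  induction h using Relation.ReflTransGen.head_induction_on with
  | refl => exact .refl
  | @head a c hac _ ih =>
    by_cases ha : a = y
    · rw [ha]
    · exact ih.head ⟨ha, hac⟩

theorem _root_.Relation.ReflTransGen.avoid_source {β : Type*} {R : β → β → Prop} {x y : β}
    (h : Relation.ReflTransGen R x y) (hxy : x ≠ y) :
    ∃ z, R x z ∧ Relation.ReflTransGen (fun a c => a ≠ x ∧ R a c) z y := by
  suffices H : ∀ w, Relation.ReflTransGen R w y →
      Relation.ReflTransGen (fun a c => a ≠ x ∧ R a c) w y ∨
      ∃ z, R x z ∧ Relation.ReflTransGen (fun a c => a ≠ x ∧ R a c) z y by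
    rcases H x h with h' | h'
    · rcases h'.cases_head with h' | ⟨c, hc, _⟩
      · exact absurd h' hxy
      · exact absurd rfl hc.1
    · exact h'
  intro w hw
  induction hw using Relation.ReflTransGen.head_induction_on with
  | refl => exact Or.inl .refl
  | @head a c hac _ ih =>
    rcases ih with ih | ih
    · by_cases ha : a = x
      · exact Or.inr ⟨c, ha ▸ hac, ih⟩
      · exact Or.inl (ih.head ⟨ha, hac⟩)
    · exact Or.inr ih

variable {α τ : Type*}

/-- Player `x` supports the price of slot `t`: he can afford it and would not lose by moving
there. -/
def Supports (θ : τ → ℝ) (v b : α → ℝ) (π : α ≃ τ) (q : τ → ℝ) (x : α) (t : τ) : Prop :=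
  q t ≤ b x ∧ θ (π x) * v x - q (π x) ≤ θ t * v x - q t

/-- If a chain of players who support the next slot leads from slot `t` to the slot of player `i`,
then `i` can be moved to `t` while every displaced player moves to a slot that he supports. -/
theorem exists_rotation [DecidableEq α] [DecidableEq τ] {S : α → τ → Prop} {ρ : α ≃ τ}
    (A : Finset τ) (π : α ≃ τ) (i : α) (t : τ)
    (hA : ∀ s ∈ A, s ≠ π i ∧ π.symm s = ρ.symm s)
    (hpath : Relation.ReflTransGen (fun x y => x ∈ A ∧ S (ρ.symm x) y) t (π i)) :
    ∃ π' : α ≃ τ, π' i = t ∧ ∀ j ≠ i, (π j ∉ A → π' j = π j) ∧ (π' j = π j ∨ S j (π' j)) := by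
  induction hn : A.card generalizing A π i t with
  | zero =>
    rcases hpath.cases_head with h | ⟨c, hc, _⟩
    · exact ⟨π, h.symm, fun j _ => ⟨fun _ => rfl, Or.inl rfl⟩⟩
    · rw [Finset.card_eq_zero] at hn
      simp [hn] at hc
  | succ n ih =>
    by_cases hti : t = π i
    · exact ⟨π, hti.symm, fun j _ => ⟨fun _ => rfl, Or.inl rfl⟩⟩
    obtain ⟨t₁, ⟨htA, hS⟩, hpath'⟩ := hpath.avoid_source hti
    set k := ρ.symm t with hk
    have hkt : π k = t := by rw [hk, ← (hA t htA).2, Equiv.apply_symm_apply]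
    have hki : k ≠ i := fun e => hti (by rw [← hkt, e])
    -- After `i` and `k` are swapped, `k` sits provisionally in the old slot of `i` and has to be
    -- moved to `t₁`. The slots still in `A` have kept their holders.
    obtain ⟨π', h1, h2⟩ := ih (A.erase t) ((Equiv.swap i k).trans π) k t₁
      (by
        intro s hs
        obtain ⟨hst, hsA⟩ := Finset.mem_erase.1 hs
        have hsi := (hA s hsA).1
        refine ⟨by simpa using hsi, ?_⟩
        rw [Equiv.symm_trans_apply, Equiv.symm_swap, Equiv.swap_apply_of_ne_of_ne]
        · exact (hA s hsA).2
        · exact fun e => hsi (by rw [← e, Equiv.apply_symm_apply])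
        · exact fun e => hst (by rw [← hkt, ← e, Equiv.apply_symm_apply]))
      (by
        simp only [Equiv.trans_apply, Equiv.swap_apply_right]
        exact Relation.ReflTransGen.mono
          (fun x y hxy => ⟨Finset.mem_erase.2 ⟨hxy.1, hxy.2.1⟩, hxy.2.2⟩) _ _ hpath')
      (by rw [Finset.card_erase_of_mem htA, hn]; rfl)
    have hi : π' i = t := by
      have := (h2 i hki.symm).1
      simp only [Equiv.trans_apply, Equiv.swap_apply_left, hkt] at this
      exact this (by simp)
    refine ⟨π', hi, fun j hj => ?_⟩
    by_cases hjk : j = k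
    · subst hjk
      exact ⟨fun h => absurd (hkt ▸ htA) h, Or.inr (h1 ▸ hS)⟩
    · have := h2 j hjk
      simp only [Equiv.trans_apply, Equiv.swap_apply_of_ne_of_ne hj hjk] at this
      exact ⟨fun h => this.1 (fun h' => h (Finset.mem_of_mem_erase h')), this.2⟩

variable [Fintype α] [Fintype τ] {θ : τ → ℝ} {v b : α → ℝ} {π : α ≃ τ} {q : τ → ℝ}

/-- The support relation on slots: the holder of `s` supports `t`. -/
def SlotSupports (θ : τ → ℝ) (v b : α → ℝ) (π : α ≃ τ) (q : τ → ℝ) (s t : τ) : Prop :=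
  Supports θ v b π q (π.symm s) t

/-- Otherwise `i` moves to `t` and the displaced players move along the chain. Nobody loses and `i`
gains at unchanged prices, so the new matching is an equilibrium of larger total value, against
`le_sum`. -/
theorem IsLeastEq.not_path (h : IsLeastEq θ v b π q) {i : α} {t : τ} (hit : q t ≤ b i)
    (hlt : θ (π i) * v i - q (π i) < θ t * v i - q t)
    (hpath : Relation.ReflTransGen (SlotSupports θ v b π q) t (π i)) : False := by
  classical
  obtain ⟨π', h1, h2⟩ := exists_rotation (S := Supports θ v b π q) (ρ := π)
    (Finset.univ.erase (π i)) π i t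
    (fun s hs => ⟨Finset.ne_of_mem_erase hs, rfl⟩)
    (Relation.ReflTransGen.mono (fun x y hxy => ⟨by simpa using hxy.1, hxy.2⟩) _ _
      hpath.avoid_target)
  have hu : ∀ j, θ (π j) * v j - q (π j) ≤ θ (π' j) * v j - q (π' j) := by
    intro j
    by_cases hj : j = i
    · subst hj; rw [h1]; exact hlt.le
    · rcases (h2 j hj).2 with e | e
      · rw [e]
      · exact e.2
  have heq : IsApproxEq θ v b 0 π' q := by
    refine ⟨h.isEq.nonneg, h.isEq.exists_zero, fun j => ?_, fun j s => ?_⟩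
    · by_cases hj : j = i
      · subst hj; rwa [h1]
      · rcases (h2 j hj).2 with e | e
        · rw [e]; exact h.isEq.afford j
        · exact e.1
    · exact (h.isEq.no_envy j s).imp id fun h' => h'.trans (hu j)
  have hsum : ∑ j, (θ (π j) * v j - q (π j)) < ∑ j, (θ (π' j) * v j - q (π' j)) :=
    Finset.sum_lt_sum (fun j _ => hu j) ⟨i, Finset.mem_univ i, by rw [h1]; exact hlt⟩
  rw [Finset.sum_sub_distrib, Finset.sum_sub_distrib, Equiv.sum_comp π q, Equiv.sum_comp π' q]
    at hsum
  linarith [h.le_sum π' heq]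

/-- All prices in `Z` could be lowered by a common `δ` smaller than every positive slack in prices,
budgets and utilities, against `sum_le`. -/
theorem IsLeastEq.not_lower_of_no_strict (h : IsLeastEq θ v b π q) {Z : Finset τ}
    (hZ : Z.Nonempty) (hpos : ∀ t ∈ Z, 0 < q t)
    (hcl : ∀ t ∈ Z, ∀ x, Supports θ v b π q x t → π x ∈ Z)
    (hns : ∀ t ∈ Z, ∀ x, Supports θ v b π q x t →
      θ t * v x - q t ≤ θ (π x) * v x - q (π x)) : False := by
  classical
  obtain ⟨δ, hδ, hle⟩ := (((Set.finite_range q).union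
    (Set.finite_range fun z : α × τ => q z.2 - b z.1)).union
    (Set.finite_range fun z : α × τ =>
      θ (π z.1) * v z.1 - q (π z.1) - (θ z.2 * v z.1 - q z.2))).exists_pos_le
  have h1 : ∀ t ∈ Z, δ ≤ q t := fun t ht => hle _ (Or.inl (Or.inl ⟨t, rfl⟩)) (hpos t ht)
  have h2 : ∀ x t, b x < q t → δ ≤ q t - b x := fun x t hlt =>
    hle _ (Or.inl (Or.inr ⟨(x, t), rfl⟩)) (sub_pos.2 hlt)
  have h3 : ∀ x t, θ t * v x - q t < θ (π x) * v x - q (π x) →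
      δ ≤ θ (π x) * v x - q (π x) - (θ t * v x - q t) := fun x t hlt =>
    hle _ (Or.inr ⟨(x, t), rfl⟩) (sub_pos.2 hlt)
  set q' : τ → ℝ := fun t => if t ∈ Z then q t - δ else q t with hq'
  have hq'le : ∀ t, q' t ≤ q t := fun t => by simp only [hq']; split_ifs <;> linarith
  have heq : IsApproxEq θ v b 0 π q' := by
    refine ⟨fun t => ?_, ?_, fun i => (hq'le _).trans (h.isEq.afford i), fun x t => ?_⟩
    · simp only [hq']; split_ifs with ht
      · linarith [h1 t ht]
      · exact h.isEq.nonneg t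
    · obtain ⟨t, ht⟩ := h.isEq.exists_zero
      refine ⟨t, ?_⟩
      have : t ∉ Z := fun hc => (hpos t hc).ne' ht
      simp [hq', this, ht]
    · by_cases ht : t ∈ Z
      · by_cases hx : π x ∈ Z
        · simp only [hq', ht, hx, if_true]
          rcases h.isEq.no_envy x t with h' | h'
          · rcases le_or_gt (θ t * v x - q t) (θ (π x) * v x - q (π x)) with h4 | h4
            · right; linarith
            · rcases lt_or_ge (b x) (q t) with h5 | h5
              · left; linarith [h2 x t h5]
              · exact absurd (hns t ht x ⟨h5, h4.le⟩) (not_le.2 h4)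
          · right; linarith
        · simp only [hq', ht, hx, if_true, if_false]
          have hn : ¬ Supports θ v b π q x t := fun hs => hx (hcl t ht x hs)
          rw [Supports, not_and_or, not_le, not_le] at hn
          rcases hn with hn | hn
          · left; linarith [h2 x t hn]
          · right; linarith [h3 x t hn]
      · rcases h.isEq.no_envy x t with h' | h'
        · left; simpa [hq', ht] using h'
        · right
          have := hq'le (π x)
          have e : q' t = q t := by simp [hq', ht]
          rw [e]; linarith
  have := h.sum_le π q' heq
  have hlt : ∑ t, q' t < ∑ t, q t := by
    obtain ⟨t, ht⟩ := hZ
    exact Finset.sum_lt_sum (fun t _ => hq'le t) ⟨t, Finset.mem_univ t, by simp [hq', ht, hδ]⟩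
  linarith

/-- In a least equilibrium every nonempty set of slots with positive prices has a price that is
supported by a player outside the set. -/
theorem IsLeastEq.not_lower (h : IsLeastEq θ v b π q) (Z : Finset τ) (hZ : Z.Nonempty)
    (hpos : ∀ t ∈ Z, 0 < q t) (hcl : ∀ t ∈ Z, ∀ x, Supports θ v b π q x t → π x ∈ Z) :
    False := by
  classical
  induction hn : Z.card using Nat.strong_induction_on generalizing Z with
  | _ n ih =>
    subst hn
    refine h.not_lower_of_no_strict hZ hpos hcl fun t ht x hx => ?_
    by_contra! hlt
    have hback : ∀ w, Relation.ReflTransGen (SlotSupports θ v b π q) w (π x) → w ∈ Z := by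
      intro w hw
      induction hw using Relation.ReflTransGen.head_induction_on with
      | refl => exact hcl t ht x hx
      | @head a c hac _ ih' => simpa using hcl c ih' _ hac
    -- Some `x` strictly prefers `t` and is stopped only by his budget. The slots with a chain to
    -- the slot of `x` again form a closed set, strictly smaller since it omits `t` by `not_path`.
    set Z' := Z.filter fun w => Relation.ReflTransGen (SlotSupports θ v b π q) w (π x) with hZ'
    have htn : t ∉ Z' := fun hc => h.not_path hx.1 hlt (Finset.mem_filter.1 hc).2
    refine ih Z'.card (Finset.card_lt_card ⟨Finset.filter_subset _ _, fun hc => htn (hc ht)⟩) Z'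
      ⟨π x, Finset.mem_filter.2 ⟨hcl t ht x hx, .refl⟩⟩
      (fun w hw => hpos w (Finset.mem_filter.1 hw).1) (fun w hw y hy => ?_) rfl
    have hpath : Relation.ReflTransGen (SlotSupports θ v b π q) (π y) (π x) :=
      (Finset.mem_filter.1 hw).2.head (by rw [SlotSupports, Equiv.symm_apply_apply]; exact hy)
    exact Finset.mem_filter.2 ⟨hback _ hpath, hpath⟩

end BudgetAuction

/-! ### Price chains and perturbed budgets -/

namespace BudgetAuction

variable {α τ : Type*} {θ : τ → ℝ} {v b : α → ℝ} {π : α ≃ τ} {q : τ → ℝ}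

/-- The holder of a worse but dearer slot could strictly afford the better one and would gain by
moving. -/
theorem IsApproxEq.price_mono (h : IsApproxEq θ v b 0 π q) (hv : ∀ i, 0 ≤ v i) {s t : τ}
    (hst : θ s ≤ θ t) : q s ≤ q t := by
  by_contra! hlt
  have h1 := h.afford (π.symm s)
  have h2 := h.no_envy (π.symm s) t
  rw [Equiv.apply_symm_apply] at h1 h2
  rcases h2 with h2 | h2
  · linarith
  · nlinarith [mul_le_mul_of_nonneg_right hst (hv (π.symm s))]

/-- A lower slot is no dearer than the slot already paid for, so the budget exemption can apply only
when the two prices coincide. -/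
theorem IsApproxEq.no_envy_down (h : IsApproxEq θ v b 0 π q) (hv : ∀ i, 0 ≤ v i) {j : α} {t : τ}
    (ht : θ t ≤ θ (π j)) : θ t * v j - q t ≤ θ (π j) * v j - q (π j) := by
  rcases h.no_envy j t with h1 | h1
  · have h2 := h.price_mono hv ht
    have h3 := h.afford j
    linarith [mul_le_mul_of_nonneg_right ht (hv j)]
  · linarith

theorem IsApproxEq.utility_nonneg (h : IsApproxEq θ v b 0 π q) (hv : ∀ i, 0 ≤ v i)
    (hθ : ∀ t, 0 ≤ θ t) {j : α} (hb : 0 < b j) : 0 ≤ θ (π j) * v j - q (π j) := by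
  obtain ⟨t, ht⟩ := h.exists_zero
  have := mul_nonneg (hθ t) (hv j)
  rcases h.no_envy j t with h1 | h1 <;> linarith

/-- The possible differences of the prices of the ends of a chain of `m` slots in which the holder
of each slot is indifferent to the next one. -/
def chainSums (θ : τ → ℝ) (v : α → ℝ) : ℕ → Set ℝ
  | 0 => {0}
  | m + 1 => Set.image2 (fun c (z : α × τ × τ) => c + (θ z.2.2 - θ z.2.1) * v z.1)
      (chainSums θ v m) Set.univ

theorem finite_chainSums [Finite α] [Finite τ] (θ : τ → ℝ) (v : α → ℝ) (m : ℕ) :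
    (chainSums θ v m).Finite := by
  induction m with
  | zero => exact Set.finite_singleton _
  | succ m ih => exact ih.image2 _ Set.finite_univ

theorem chainSums_step {m : ℕ} {c : ℝ} (hc : c ∈ chainSums θ v m) (x : α) (s t : τ) :
    c + (θ t - θ s) * v x ∈ chainSums θ v (m + 1) :=
  ⟨c, hc, (x, s, t), Set.mem_univ _, rfl⟩

theorem chainSums_succ {m : ℕ} {c : ℝ} (hc : c ∈ chainSums θ v m) (x : α) (s : τ) :
    c ∈ chainSums θ v (m + 1) := by
  simpa using chainSums_step hc x s s

variable [Fintype α] [Fintype τ]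

/-- A set of slots that is closed under support and omits `s` is not entered from above `s` to
below `s`. -/
theorem IsLeastEq.not_cross (h : IsLeastEq θ v b π q) (hv : ∀ i, 0 ≤ v i) {C : Set τ}
    (hC : ∀ a ∈ C, ∀ c, SlotSupports θ v b π q a c → c ∈ C) {x y s : τ} (hx : x ∈ C)
    (hxy : SlotSupports θ v b π q x y) (hs : s ∉ C) (hys : θ y ≤ θ s) (hsx : θ s < θ x) :
    False := by
  classical
  have hE := h.isEq
  obtain ⟨j, rfl⟩ := π.surjective x
  have hyC := hC _ hx y hxy
  rw [SlotSupports, Equiv.symm_apply_apply] at hxy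
  obtain ⟨hyb, hyu⟩ := hxy
  have hxb := hE.afford j
  have strict : ∀ a, a ∉ C → θ a ≤ θ (π j) →
      θ a * v j - q a < θ (π j) * v j - q (π j) := by
    intro a ha hle
    refine lt_of_le_of_ne (hE.no_envy_down hv hle) fun e => ha (hC _ hx a ?_)
    rw [SlotSupports, Equiv.symm_apply_apply]
    exact ⟨(hE.price_mono hv hle).trans hxb, e.ge⟩
  have hne : ∀ a, a ∉ C → θ a ≤ θ (π j) → θ a ≠ θ y := by
    intro a ha hle e
    have h1 := hE.price_mono hv e.le
    have h2 := strict a ha hle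
    rw [e] at h2
    linarith
  -- The slots outside `C` strictly between `y` and `x` are overpriced in the eyes of `j`. It is
  -- shown that only their own holders support them, against `not_lower`.
  set Y : Finset τ := Finset.univ.filter fun a => a ∉ C ∧ θ y < θ a ∧ θ a < θ (π j) with hY
  have hYmem : ∀ a, a ∈ Y ↔ a ∉ C ∧ θ y < θ a ∧ θ a < θ (π j) := fun a => by simp [hY]
  refine h.not_lower Y ⟨s, (hYmem s).2 ⟨hs, lt_of_le_of_ne hys (hne s hs hsx.le).symm, hsx⟩⟩
    (fun a ha => ?_) (fun a ha z hz => ?_)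
  · obtain ⟨haC, hya, hax⟩ := (hYmem a).1 ha
    have h1 := strict a haC hax.le
    have h2 := hE.nonneg y
    linarith [mul_le_mul_of_nonneg_right hya.le (hv j)]
  · obtain ⟨haC, hya, hax⟩ := (hYmem a).1 ha
    obtain ⟨hzb, hzu⟩ := hz
    have h1 := strict a haC hax.le
    have hqya := hE.price_mono hv hya.le
    have hyj : q y + (θ a - θ y) * v j < q a := by linarith
    have hlt_qya : q y < q a := by linarith [mul_nonneg (sub_nonneg.2 hya.le) (hv j)]
    have hzy : θ y * v z - q y ≤ θ (π z) * v z - q (π z) := by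
      rcases hE.no_envy z y with h2 | h2 <;> linarith
    -- Since `z` accepts a price that `j` finds excessive compared with `y`, he values clicks more.
    -- He then prefers the slot of `j` to his own, so only his budget keeps him out.
    have hvz : v j < v z := by
      have : (θ a - θ y) * v j < (θ a - θ y) * v z := by linarith
      exact lt_of_mul_lt_mul_left this (sub_nonneg.2 hya.le)
    have hzx : θ (π z) * v z - q (π z) < θ (π j) * v z - q (π j) := by
      have : (θ (π j) - θ a) * v j < (θ (π j) - θ a) * v z :=
        mul_lt_mul_of_pos_left hvz (sub_pos.2 hax)
      linarith
    have hbz : b z ≤ q (π j) := by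
      rcases hE.no_envy z (π j) with h2 | h2 <;> linarith
    have hwC : π z ∉ C := by
      intro hw
      refine haC (hC _ hw a ?_)
      rw [SlotSupports, Equiv.symm_apply_apply]
      exact ⟨hzb, hzu⟩
    have hwb := hE.afford z
    have hwx : θ (π z) < θ (π j) := by
      by_contra! hge
      have h2 := hE.price_mono hv hge
      linarith [mul_le_mul_of_nonneg_right hge (hv z)]
    refine (hYmem _).2 ⟨hwC, ?_, hwx⟩
    by_contra! hge
    have hwy : θ (π z) < θ y := lt_of_le_of_ne hge (hne _ hwC hwx.le)
    have h2 := hE.no_envy_down hv hwx.le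
    have h3 : (θ y - θ (π z)) * v j < (θ y - θ (π z)) * v z :=
      mul_lt_mul_of_pos_left hvz (sub_pos.2 hwy)
    linarith

/-- If a player at the limit of his budget envies slot `t`, then no chain of supporting players
leads from `t` to a lower slot. -/
theorem IsLeastEq.le_of_path (h : IsLeastEq θ v b π q) (hv : ∀ i, 0 ≤ v i) (hθ : ∀ t, 0 ≤ θ t)
    (hb : ∀ i, 0 < b i) {i : α} {t : τ} (hit : q t = b i)
    (hlt : θ (π i) * v i - q (π i) < θ t * v i - q t) {u : τ}
    (hu : Relation.ReflTransGen (SlotSupports θ v b π q) t u) :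
    θ (π i) < θ t ∧ θ t ≤ θ u := by
  have hE := h.isEq
  have hst : θ (π i) < θ t := by
    by_contra! hge
    exact absurd (hE.no_envy_down hv hge) (not_le.2 hlt)
  refine ⟨hst, ?_⟩
  have above : ∀ u, Relation.ReflTransGen (SlotSupports θ v b π q) t u → θ (π i) < θ u := by
    intro u hu
    induction hu with
    | refl => exact hst
    | @tail x y hx hxy ih =>
      by_contra! hle
      -- The slots reachable from `t` are closed under support and omit the slot of `i`, so no chain
      -- can jump over that slot.
      exact h.not_cross hv (C := {u | Relation.ReflTransGen (SlotSupports θ v b π q) t u})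
        (fun a ha c hac => Relation.ReflTransGen.tail ha hac) hx hxy
        (fun hc => h.not_path hit.le hlt hc) hle ih
  induction hu with
  | refl => exact le_rfl
  | @tail x y hx hxy ih =>
    by_contra! hyt
    have hsy := above y (hx.tail hxy)
    obtain ⟨j, rfl⟩ := π.surjective x
    rw [SlotSupports, Equiv.symm_apply_apply] at hxy
    obtain ⟨hyb, hyu⟩ := hxy
    have hxb := hE.afford j
    have hjt := hE.no_envy_down hv ih
    have hjs := hE.no_envy_down hv (hst.le.trans ih)
    have hj0 := hE.utility_nonneg hv hθ (hb j)
    have hqyt := hE.price_mono hv hyt.le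
    have hqtx := hE.price_mono hv ih
    have hbi := hb i
    have hjty : (θ t - θ y) * v j ≤ q t - q y := by linarith
    have hvj := hv j
    -- If the budget of `i` excuses him at `y`, then `y` and `t` cost the same, so `j` has value
    -- zero yet pays a positive price. Otherwise `i` values clicks more than `j`, and prefers `y` to
    -- his own slot because `j` does not prefer the slot of `i` to `y`.
    rcases hE.no_envy i y with h1 | h1
    · have h2 : (θ t - θ y) * v j ≤ 0 := by linarith
      have h3 : v j = 0 := by
        by_contra hne
        have := mul_pos (sub_pos.2 hyt) (lt_of_le_of_ne hvj (Ne.symm hne))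
        linarith
      rw [h3] at hj0
      linarith
    · have h2 : (θ t - θ y) * v j < (θ t - θ y) * v i := by linarith
      have h3 : v j < v i := lt_of_mul_lt_mul_left h2 (sub_nonneg.2 hyt.le)
      have h4 : (θ y - θ (π i)) * v j < (θ y - θ (π i)) * v i :=
        mul_lt_mul_of_pos_left h3 (sub_pos.2 hsy)
      linarith

/-- The price of slot `t` is zero or equal to the budget of a player who envies `t`. -/
def IsRoot (θ : τ → ℝ) (v b : α → ℝ) (π : α ≃ τ) (q : τ → ℝ) (t : τ) : Prop :=
  q t = 0 ∨ ∃ i, q t = b i ∧ θ (π i) * v i - q (π i) < θ t * v i - q t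

/-- Grow the set of explained slots from the roots. If it stopped short of all slots, `not_lower`
applied to its complement would give a supporter from inside: if indifferent he prolongs a chain,
and if he strictly prefers the slot it is itself a root. -/
theorem IsLeastEq.exists_root (h : IsLeastEq θ v b π q) (u : τ) :
    ∃ t, IsRoot θ v b π q t ∧ Relation.ReflTransGen (SlotSupports θ v b π q) t u ∧
      q u - q t ∈ chainSums θ v (Fintype.card τ + 1) := by
  classical
  have hE := h.isEq
  set A : ℕ → Finset τ := fun m => Finset.univ.filter fun u =>
    ∃ t, IsRoot θ v b π q t ∧ Relation.ReflTransGen (SlotSupports θ v b π q) t u ∧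
      q u - q t ∈ chainSums θ v m with hA
  have hmem : ∀ m u, u ∈ A m ↔ ∃ t, IsRoot θ v b π q t ∧
      Relation.ReflTransGen (SlotSupports θ v b π q) t u ∧ q u - q t ∈ chainSums θ v m :=
    fun m u => by simp [hA]
  have hsub : ∀ m, A m ⊆ A (m + 1) := by
    intro m u hu
    obtain ⟨t, h1, h2, h3⟩ := (hmem m u).1 hu
    exact (hmem _ u).2 ⟨t, h1, h2, chainSums_succ h3 (π.symm u) u⟩
  have hroot : ∀ m t, IsRoot θ v b π q t → t ∈ A m := by
    intro m t ht
    induction m with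
    | zero => exact (hmem 0 t).2 ⟨t, ht, .refl, by simp [chainSums]⟩
    | succ m ih => exact hsub m ih
  have key : ∀ m, A m = Finset.univ ∨ m ≤ (A m).card := by
    intro m
    induction m with
    | zero => exact Or.inr (Nat.zero_le _)
    | succ m ih =>
      by_cases hu : A m = Finset.univ
      · exact Or.inl (Finset.univ_subset_iff.1 (hu ▸ hsub m))
      have hcard := ih.resolve_left hu
      right
      refine hcard.trans_lt (Finset.card_lt_card ((hsub m).ssubset_of_ne fun heq => ?_))
      refine h.not_lower (A m)ᶜ ?_ (fun t ht => ?_) (fun t ht x hx => ?_)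
      · rwa [Finset.nonempty_iff_ne_empty, Ne, Finset.compl_eq_empty_iff]
      · refine lt_of_le_of_ne (hE.nonneg t) fun e => ?_
        exact Finset.mem_compl.1 ht (hroot m t (Or.inl e.symm))
      · rw [Finset.mem_compl] at ht ⊢
        intro hxA
        rcases hx.2.eq_or_lt with he | hlt
        · obtain ⟨t₀, h1, h2, h3⟩ := (hmem m _).1 hxA
          refine ht (heq ▸ (hmem _ t).2 ⟨t₀, h1, h2.tail ?_, ?_⟩)
          · rw [SlotSupports, Equiv.symm_apply_apply]
            exact hx
          · convert chainSums_step h3 x (π x) t using 1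
            linarith
        · refine ht (hroot m t (Or.inr ⟨x, le_antisymm hx.1 ?_, hlt⟩))
          rcases hE.no_envy x t with h1 | h1 <;> linarith
  have := key (Fintype.card τ + 1)
  rcases this with h1 | h1
  · exact (hmem _ u).1 (h1 ▸ Finset.mem_univ u)
  · have := (A (Fintype.card τ + 1)).card_le_univ
    omega

/-- Envy-free matchings of players and slots, in terms of the total prices of the slots. -/
structure IsPriceEq (θ : τ → ℝ) (v B : α → ℝ) (π : α ≃ τ) (q : τ → ℝ) : Prop where
  nonneg : ∀ t, 0 ≤ q t
  exists_zero : ∃ t, q t = 0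
  afford : ∀ i, q (π i) ≤ B i
  no_envy : ∀ i t, q t ≤ B i → θ t * v i - q t ≤ θ (π i) * v i - q (π i)

theorem exists_isPriceEq [Nonempty τ] {B : α → ℝ} (hcard : Fintype.card α = Fintype.card τ)
    (hθ : ∀ t, 0 ≤ θ t) (hv : ∀ i, 0 ≤ v i) (hB : ∀ i, 0 ≤ B i) (hinj : Function.Injective B) :
    ∃ π q, IsPriceEq θ v B π q := by
  set D := chainSums θ v (Fintype.card τ + 1)
  have hD : D.Finite := finite_chainSums θ v _
  -- `D` depends only on rates and values, so `η` can be fixed before the perturbation it controls.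
  obtain ⟨η, hη, hgap⟩ := (((hD.image2 (fun c l => |c - B l|) Set.finite_univ).union
    (hD.image2 (fun c (z : α × α) => |B z.1 + c - B z.2|) Set.finite_univ))).exists_pos_le
  have hgap1 : ∀ c ∈ D, ∀ l, |c - B l| < η → c = B l := by
    intro c hc l hl
    by_contra hne
    exact absurd (hgap _ (Or.inl ⟨c, hc, l, Set.mem_univ _, rfl⟩) (abs_pos.2 (sub_ne_zero.2 hne)))
      (not_le.2 hl)
  have hgap2 : ∀ c ∈ D, ∀ i l, |B i + c - B l| < η → B i + c = B l := by
    intro c hc i l hl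
    by_contra hne
    exact absurd (hgap _ (Or.inr ⟨c, hc, (i, l), Set.mem_univ _, rfl⟩)
      (abs_pos.2 (sub_ne_zero.2 hne))) (not_le.2 hl)
  set ε : α → ℝ := fun i => (η / 2) / (1 + B i) with hε
  have hε0 : ∀ i, 0 < ε i := fun i => by have := hB i; simp only [hε]; positivity
  have hεη : ∀ i, ε i < η := fun i => by
    have := hB i
    have : ε i ≤ η / 2 := div_le_self (by linarith) (by linarith)
    linarith
  have hεB : ∀ i l, ε i ≤ ε l → B l ≤ B i := fun i l hil => by
    have h1 := hB i
    have h2 := hB l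
    have := (div_le_div_iff_of_pos_left (by positivity : 0 < η / 2) (by positivity)
      (by positivity)).1 hil
    linarith
  have hb0 : ∀ i, 0 < B i + ε i := fun i => add_pos_of_nonneg_of_pos (hB i) (hε0 i)
  obtain ⟨π, q, h⟩ := exists_isLeastEq (θ := θ) (v := v) (b := fun i => B i + ε i)
    (fun i => (hb0 i).le) hcard
  have hE := h.isEq
  refine ⟨π, q, hE.nonneg, hE.exists_zero, fun l => ?_, fun i t hit => ?_⟩
  · by_contra! hlt
    have hub := hE.afford l
    obtain ⟨t, ht, hpath, hc⟩ := h.exists_root (π l)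
    rcases ht with ht | ⟨i, hti, henvy⟩
    · rw [ht, sub_zero] at hc
      have := hgap1 _ hc l (by rw [abs_lt]; constructor <;> linarith [hεη l])
      linarith
    -- Here the price of the slot of `l` is exactly `B l + ε i`. Affordability gives `B l ≤ B i`;
    -- the monotonicity of prices along the chain gives the reverse.
    · have h1 := hgap2 _ hc i l (by
        rw [hti, abs_lt]; constructor <;> linarith [hεη l, hεη i, hε0 i, hε0 l])
      have h2 : B l ≤ B i := hεB i l (by linarith)
      obtain ⟨h3, h4⟩ := h.le_of_path hv hθ hb0 hti henvy hpath
      have h5 := hE.price_mono hv h4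
      have h6 : l = i := hinj (le_antisymm h2 (by linarith))
      subst h6
      linarith
  · rcases hE.no_envy i t with h1 | h1
    · linarith [hε0 i]
    · linarith

end BudgetAuction

/-! ### From prices to ranks and bids -/

namespace BudgetAuction

section PriceEq

variable {α τ : Type*} {θ : τ → ℝ} {v B : α → ℝ} {π : α ≃ τ} {q : τ → ℝ}

theorem IsPriceEq.isApproxEq (h : IsPriceEq θ v B π q) : IsApproxEq θ v B 0 π q := by
  refine ⟨h.nonneg, h.exists_zero, h.afford, fun i t => ?_⟩
  rcases le_total (q t) (B i) with h1 | h1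
  · right; simpa using h.no_envy i t h1
  · left; simpa using h1

theorem IsPriceEq.utility_nonneg (h : IsPriceEq θ v B π q) (hθ : ∀ t, 0 ≤ θ t)
    (hv : ∀ i, 0 ≤ v i) (hB : ∀ i, 0 ≤ B i) (i : α) : 0 ≤ θ (π i) * v i - q (π i) := by
  obtain ⟨t, ht⟩ := h.exists_zero
  have := h.no_envy i t (ht ▸ hB i)
  linarith [mul_nonneg (hθ t) (hv i)]

theorem IsPriceEq.price_eq_zero (h : IsPriceEq θ v B π q) (hv : ∀ i, 0 ≤ v i) {t : τ}
    (ht : ∀ s, θ t ≤ θ s) : q t = 0 := by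
  obtain ⟨s, hs⟩ := h.exists_zero
  exact le_antisymm (hs ▸ h.isApproxEq.price_mono hv (ht s)) (h.nonneg t)

theorem IsPriceEq.swap [DecidableEq α] (h : IsPriceEq θ v B π q) {x y : α}
    (hq : q (π x) = q (π y)) (hx : θ (π x) * v x = θ (π y) * v x)
    (hy : θ (π x) * v y = θ (π y) * v y) : IsPriceEq θ v B ((Equiv.swap x y).trans π) q := by
  have key : ∀ i, q (π (Equiv.swap x y i)) = q (π i) ∧
      θ (π (Equiv.swap x y i)) * v i = θ (π i) * v i := by
    intro i
    by_cases h1 : i = x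
    · subst h1; simp [hq, hx]
    · by_cases h2 : i = y
      · subst h2; simp [hq, hy]
      · rw [Equiv.swap_apply_of_ne_of_ne h1 h2]; simp
  refine ⟨h.nonneg, h.exists_zero, fun i => ?_, fun i t ht => ?_⟩
  · rw [Equiv.trans_apply, (key i).1]; exact h.afford i
  · rw [Equiv.trans_apply, (key i).1, (key i).2]; exact h.no_envy i t ht

end PriceEq

variable {n k : ℕ}

/-- The click-through rate of the slot of a given rank, zero if there is no such slot. -/
noncomputable def Setting.rate (S : Setting n k) (t : Fin n) : ℝ :=
  if h : (t : ℕ) < k then S.ctr ⟨t, h⟩ else 0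

theorem Setting.IsAdmissible.rate_nonneg {S : Setting n k} (hS : S.IsAdmissible) (t : Fin n) :
    0 ≤ S.rate t := by
  unfold Setting.rate
  split_ifs with h
  · exact (hS.ctr_pos _).le
  · exact le_rfl

theorem Setting.IsAdmissible.rate_lt {S : Setting n k} (hS : S.IsAdmissible) {s t : Fin n}
    (hst : s < t) (hs : (s : ℕ) < k) : S.rate t < S.rate s := by
  unfold Setting.rate
  rw [dif_pos hs]
  split_ifs with h
  · exact hS.ctr_strictAnti (Fin.mk_lt_mk.2 hst)
  · exact hS.ctr_pos _

theorem Setting.rate_eq_zero (S : Setting n k) {t : Fin n} (ht : k ≤ t) : S.rate t = 0 := by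
  rw [Setting.rate, dif_neg (not_lt.2 ht)]

theorem Setting.IsAdmissible.rate_antitone {S : Setting n k} (hS : S.IsAdmissible) :
    Antitone S.rate := by
  intro s t hst
  by_cases hs : (s : ℕ) < k
  · rcases hst.eq_or_lt with rfl | h
    · exact le_rfl
    · exact (hS.rate_lt h hs).le
  · rw [S.rate_eq_zero ((not_lt.1 hs).trans hst), S.rate_eq_zero (not_lt.1 hs)]

/-- The budget-bid of the player of rank `t`: the total price of the slot above. -/
noncomputable def rankBid (q : Fin n → ℝ) (t : Fin n) : ℝ :=
  if (t : ℕ) = 0 then q t + 1 else q ⟨t - 1, (Nat.sub_le _ _).trans_lt t.2⟩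

theorem rankBid_nonneg {q : Fin n → ℝ} (hq : ∀ t, 0 ≤ q t) (t : Fin n) : 0 ≤ rankBid q t := by
  unfold rankBid
  split_ifs
  · linarith [hq t]
  · exact hq _

theorem rankBid_succ (q : Fin n → ℝ) {j : ℕ} (hj : j + 1 < n) :
    rankBid q ⟨j + 1, hj⟩ = q ⟨j, (Nat.lt_succ_self j).trans hj⟩ := by
  simp [rankBid]

theorem rankBid_antitone {q : Fin n → ℝ} (hq : Antitone q) : Antitone (rankBid q) := by
  intro s t hst
  have hst' : (s : ℕ) ≤ t := hst
  unfold rankBid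
  by_cases ht : (t : ℕ) = 0
  · have : s = t := Fin.ext (by omega)
    rw [this]
  · rw [if_neg ht]
    split_ifs with hs
    · have : q ⟨t - 1, (Nat.sub_le _ _).trans_lt t.2⟩ ≤ q s := hq (Fin.mk_le_mk.2 (by omega))
      linarith
    · exact hq (Fin.mk_le_mk.2 (by omega))

theorem sum_mul_lt_sum_swap_mul (π : Equiv.Perm (Fin n)) (w : Fin n → Fin n) {x y : Fin n}
    (hπ : π x < π y) (hw : w y < w x) :
    ∑ i, (π i : ℕ) * (w i : ℕ) < ∑ i, (π (Equiv.swap x y i) : ℕ) * (w i : ℕ) := by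
  have hxy : y ≠ x := fun e => (e ▸ hπ).ne rfl
  have split : ∀ f : Fin n → ℕ, ∑ i, f i = f x + (f y + ∑ i ∈ (Finset.univ.erase x).erase y, f i) :=
    fun f => by
      rw [Finset.add_sum_erase _ _ (Finset.mem_erase.2 ⟨hxy, Finset.mem_univ y⟩),
        Finset.add_sum_erase _ _ (Finset.mem_univ x)]
  rw [split, split fun i => (π (Equiv.swap x y i) : ℕ) * (w i : ℕ)]
  have : ∑ i ∈ (Finset.univ.erase x).erase y, (π (Equiv.swap x y i) : ℕ) * (w i : ℕ) =
      ∑ i ∈ (Finset.univ.erase x).erase y, (π i : ℕ) * (w i : ℕ) := by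
    refine Finset.sum_congr rfl fun i hi => ?_
    rw [Finset.mem_erase, Finset.mem_erase] at hi
    rw [Equiv.swap_apply_of_ne_of_ne hi.2.1 hi.1]
  rw [this, Equiv.swap_apply_left, Equiv.swap_apply_right]
  have h1 : (π x : ℕ) < π y := hπ
  have h2 : (w y : ℕ) < w x := hw
  nlinarith

/-- There is an equilibrium whose ranking of the players agrees with the ranking by `rankBid`,
ties being broken by the order of the players. -/
theorem exists_sorted_isPriceEq (S : Setting n k) (hS : S.IsAdmissible) [NeZero n] :
    ∃ (π : Equiv.Perm (Fin n)) (q : Fin n → ℝ), IsPriceEq S.rate S.value S.budget π q ∧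
      ∀ x y, π x < π y → rankBid q (π y) < rankBid q (π x) ∨
        (rankBid q (π y) = rankBid q (π x) ∧ S.tie x < S.tie y) := by
  obtain ⟨π₀, q, h₀⟩ := exists_isPriceEq rfl hS.rate_nonneg hS.value_nonneg hS.budget_nonneg
    hS.budget_injective
  -- By rearrangement, a maximizer has no pair in the wrong tie order whose exchange preserves the
  -- equilibrium.
  obtain ⟨π, hπ, hmax⟩ := Set.exists_max_image
    {π : Equiv.Perm (Fin n) | IsPriceEq S.rate S.value S.budget π q}
    (fun π => ∑ i, (π i : ℕ) * (S.tie i : ℕ)) (Set.toFinite _) ⟨π₀, h₀⟩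
  have hE : IsPriceEq S.rate S.value S.budget π q := hπ
  have hv := hS.value_nonneg
  have hq : Antitone q := fun s t hst => hE.isApproxEq.price_mono hv (hS.rate_antitone hst)
  refine ⟨π, q, hE, fun x y hxy => ?_⟩
  rcases (rankBid_antitone hq hxy.le).lt_or_eq with hlt | heq
  · exact Or.inl hlt
  refine Or.inr ⟨heq, ?_⟩
  by_contra! htie
  have htie' : S.tie y < S.tie x :=
    lt_of_le_of_ne htie fun e => hxy.ne (congrArg π (S.tie.injective e).symm)
  have hxy' : (π x : ℕ) < π y := hxy
  -- The extra 1 in `rankBid` keeps the top bid out of ties.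
  have hx0 : (π x : ℕ) ≠ 0 := by
    intro hx0
    have : q ⟨π y - 1, (Nat.sub_le _ _).trans_lt (π y).2⟩ ≤ q (π x) :=
      hq (Fin.le_def.2 (by dsimp only; omega))
    rw [rankBid, rankBid, if_pos hx0, if_neg (by omega)] at heq
    linarith
  set r : Fin n := ⟨π x - 1, (Nat.sub_le _ _).trans_lt (π x).2⟩ with hr
  have hrx : r < π x := Fin.lt_def.2 (by simp only [hr]; omega)
  have hqr : q r = q (π x) := by
    rw [rankBid, rankBid, if_neg hx0, if_neg (by omega)] at heq
    refine le_antisymm ?_ (hq hrx.le)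
    rw [hr, ← heq]
    exact hq (Fin.le_def.2 (by dsimp only; omega))
  have hu := hE.utility_nonneg hS.rate_nonneg hv hS.budget_nonneg
  -- Equal bids mean that `x` could have the slot `r` above his at the price he pays. So either `r`
  -- is a padding slot, or `x` has value zero, hence price zero, and then `y` too has value zero. In
  -- both cases exchanging `x` and `y` changes nothing.
  have main : q (π x) = 0 ∧ S.rate (π x) * S.value x = S.rate (π y) * S.value x ∧
      S.rate (π x) * S.value y = S.rate (π y) * S.value y := by
    by_cases hrk : (r : ℕ) < k
    · have hx : S.value x = 0 := by
        have h1 := hE.no_envy x r (hqr ▸ hE.afford x)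
        by_contra hne
        have := mul_lt_mul_of_pos_right (hS.rate_lt hrx hrk) (lt_of_le_of_ne (hv x) (Ne.symm hne))
        linarith
      have hqx : q (π x) = 0 := by
        have := hu x
        rw [hx] at this
        linarith [hE.nonneg (π x)]
      have hqy : q (π y) = 0 := le_antisymm (hqx ▸ hq hxy.le) (hE.nonneg _)
      have hy : S.value y = 0 := by
        have h1 := hE.no_envy y r (by rw [hqr, hqx]; exact hS.budget_nonneg y)
        by_contra hne
        have := mul_lt_mul_of_pos_right (hS.rate_lt (hrx.trans hxy) hrk)
          (lt_of_le_of_ne (hv y) (Ne.symm hne))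
        linarith
      simp [hqx, hx, hy]
    · have hrk' : k ≤ (r : ℕ) := not_lt.1 hrk
      have hrx' : (r : ℕ) < π x := hrx
      have hx : S.rate (π x) = 0 := S.rate_eq_zero (by omega)
      have hy : S.rate (π y) = 0 := S.rate_eq_zero (by omega)
      have := hu x
      rw [hx] at this
      exact ⟨by linarith [hE.nonneg (π x)], by rw [hx, hy], by rw [hx, hy]⟩
  obtain ⟨h1, h2, h3⟩ := main
  have hqy : q (π y) = 0 := le_antisymm (h1 ▸ hq hxy.le) (hE.nonneg _)
  have := hmax ((Equiv.swap x y).trans π) (hE.swap (h1.trans hqy.symm) h2 h3)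
  exact absurd this (not_le.2 (sum_mul_lt_sum_swap_mul π S.tie hxy htie'))

/-! ### The mechanism -/

theorem wins_of_slotOf_eq_some {S : Setting n k} {β : Fin n → Bid} {i : Fin n} {j : Fin k}
    (h : slotOf S β i = some j) : Wins S β j i := by
  unfold slotOf at h
  split_ifs at h with hex
  cases h
  exact hex.choose_spec

theorem utility_outcome_of_none {S : Setting n k} {β : Fin n → Bid} {i : Fin n}
    (h : slotOf S β i = none) : utility S (outcome S β) i = 0 := by
  simp [utility, outcome, h]

theorem price_outcome_of_some {S : Setting n k} {β : Fin n → Bid} {i : Fin n} {j : Fin k}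
    (h : slotOf S β i = some j) : (outcome S β).price i = priceAt S β j i := by
  simp [outcome, h]

theorem utility_outcome_of_some {S : Setting n k} {β : Fin n → Bid} {i : Fin n} {j : Fin k}
    (h : slotOf S β i = some j) : utility S (outcome S β) i =
      if S.ctr j * priceAt S β j i ≤ S.budget i then
        ((S.ctr j * (S.value i - priceAt S β j i) : ℝ) : EReal) else ⊥ := by
  simp [utility, outcome, h]

theorem card_unassigned (S : Setting n k) (β : Fin n → Bid) (hkn : k ≤ n) {m : ℕ} (hm : m ≤ k) :
    (unassigned S β m).card = n - m := by
  classical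
  induction m with
  | zero => simp [unassigned]
  | succ m ih =>
    have ih := ih (by omega)
    have hne : (unassigned S β m).Nonempty := Finset.card_pos.1 (by omega)
    obtain ⟨w, hw, huniq⟩ := existsUnique_isBest S β ⟨m, hm⟩ _ hne
    have : unassigned S β (m + 1) = (unassigned S β m).erase w := by
      rw [unassigned, dif_pos (Nat.lt_of_succ_le hm)]
      ext i
      simp only [Finset.mem_filter, Finset.mem_erase]
      constructor
      · rintro ⟨h1, h2⟩
        exact ⟨fun e => h2 (e ▸ hw), h1⟩
      · rintro ⟨h1, h2⟩
        exact ⟨h2, fun hb => h1 (huniq i hb)⟩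
    rw [this, Finset.card_erase_of_mem hw.1, ih]
    omega

theorem offer_nonneg {S : Setting n k} (hS : S.IsAdmissible) (b : Bid) (j : Fin k) :
    0 ≤ offer b (S.ctr j) :=
  le_min b.value_nonneg (div_nonneg b.budget_nonneg (hS.ctr_pos j).le)

theorem le_priceAt {S : Setting n k} {β : Fin n → Bid} {j : Fin k} {i i' : Fin n} (hne : i' ≠ i)
    (hi' : i' ∈ unassigned S β j) : offer (β i') (S.ctr j) ≤ priceAt S β j i := by
  have hmem : i' ∈ (unassigned S β j).erase i := Finset.mem_erase.2 ⟨hne, hi'⟩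
  rw [priceAt, dif_pos ⟨i', hmem⟩]
  exact Finset.le_sup' (fun i' => offer (β i') (S.ctr j)) hmem

theorem priceAt_nonneg {S : Setting n k} (hS : S.IsAdmissible) (β : Fin n → Bid) (j : Fin k)
    (i : Fin n) : 0 ≤ priceAt S β j i := by
  by_cases h : ((unassigned S β j).erase i).Nonempty
  · obtain ⟨i', hi'⟩ := h
    rw [Finset.mem_erase] at hi'
    exact (offer_nonneg hS _ j).trans (le_priceAt hi'.1 hi'.2)
  · rw [priceAt, dif_neg h]

/-- A bid with budget-bid `g` whose value-bid is too large to matter. -/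
noncomputable def Setting.budgetBid (S : Setting n k) (hS : S.IsAdmissible) (g : ℝ) (hg : 0 ≤ g) :
    Bid where
  value := g * ∑ j, 1 / S.ctr j
  budget := g
  value_nonneg := mul_nonneg hg (Finset.sum_nonneg fun j _ => one_div_nonneg.2 (hS.ctr_pos j).le)
  budget_nonneg := hg

theorem offer_budgetBid {S : Setting n k} (hS : S.IsAdmissible) {g : ℝ} (hg : 0 ≤ g) (j : Fin k) :
    offer (S.budgetBid hS g hg) (S.ctr j) = g / S.ctr j := by
  refine min_eq_right ?_
  rw [div_eq_mul_one_div]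
  exact mul_le_mul_of_nonneg_left (Finset.single_le_sum (f := fun j => 1 / S.ctr j)
    (fun j _ => one_div_nonneg.2 (hS.ctr_pos j).le) (Finset.mem_univ j)) hg

/-! ### Allocation when offers follow a ranking -/

section Sorted

variable {S : Setting n k} {β : Fin n → Bid} {π : Equiv.Perm (Fin n)} {g : Fin n → ℝ}

theorem isBest_iff_of_sorted (hS : S.IsAdmissible)
    (hoff : ∀ i j, offer (β i) (S.ctr j) = g i / S.ctr j)
    (hord : ∀ x y, π x < π y → g y < g x ∨ (g y = g x ∧ S.tie x < S.tie y)) (j : Fin k)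
    (i : Fin n) :
    IsBest S β j (Finset.univ.filter fun i => (j : ℕ) ≤ π i) i ↔ (π i : ℕ) = j := by
  have hbest : ∀ i, (π i : ℕ) = j →
      IsBest S β j (Finset.univ.filter fun i => (j : ℕ) ≤ π i) i := by
    intro i hi
    refine ⟨by simp [hi], fun i' hi' hne => ?_⟩
    have h1 : (j : ℕ) ≤ π i' := (Finset.mem_filter.1 hi').2
    have h2 : π i < π i' := lt_of_le_of_ne (Fin.le_def.2 (hi ▸ h1))
      fun e => hne (π.injective e).symm
    rw [Beats, hoff, hoff]
    rcases hord i i' h2 with h3 | ⟨h3, h4⟩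
    · exact Or.inl (div_lt_div_of_pos_right h3 (hS.ctr_pos j))
    · exact Or.inr ⟨by rw [h3], h4⟩
  refine ⟨fun h => ?_, hbest i⟩
  have hw := hbest (π.symm ⟨j, j.2.trans_le hS.slots_le_players⟩) (by simp)
  obtain ⟨w, _, huniq⟩ := existsUnique_isBest S β j _ ⟨i, h.1⟩
  rw [huniq i h, ← huniq _ hw]
  simp

theorem unassigned_of_sorted (hS : S.IsAdmissible)
    (hoff : ∀ i j, offer (β i) (S.ctr j) = g i / S.ctr j)
    (hord : ∀ x y, π x < π y → g y < g x ∨ (g y = g x ∧ S.tie x < S.tie y)) {m : ℕ}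
    (hm : m ≤ k) : unassigned S β m = Finset.univ.filter fun i => m ≤ (π i : ℕ) := by
  induction m with
  | zero => simp [unassigned]
  | succ m ih =>
    have hbest := isBest_iff_of_sorted hS hoff hord ⟨m, hm⟩
    rw [unassigned, dif_pos (Nat.lt_of_succ_le hm), ih (by omega)]
    ext i
    have := hbest i
    simp only at this
    simp only [Finset.mem_filter, Finset.mem_univ, true_and, this]
    omega

theorem wins_iff_of_sorted (hS : S.IsAdmissible)
    (hoff : ∀ i j, offer (β i) (S.ctr j) = g i / S.ctr j)
    (hord : ∀ x y, π x < π y → g y < g x ∨ (g y = g x ∧ S.tie x < S.tie y)) (j : Fin k)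
    (i : Fin n) : Wins S β j i ↔ (π i : ℕ) = j := by
  rw [Wins, unassigned_of_sorted hS hoff hord j.2.le, isBest_iff_of_sorted hS hoff hord]

theorem slotOf_of_sorted (hS : S.IsAdmissible)
    (hoff : ∀ i j, offer (β i) (S.ctr j) = g i / S.ctr j)
    (hord : ∀ x y, π x < π y → g y < g x ∨ (g y = g x ∧ S.tie x < S.tie y)) (i : Fin n) :
    slotOf S β i = if h : (π i : ℕ) < k then some ⟨π i, h⟩ else none := by
  have hw := wins_iff_of_sorted hS hoff hord
  cases hs : slotOf S β i with
  | none =>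
    rw [dif_neg]
    intro h
    rw [slotOf, dif_pos ⟨⟨π i, h⟩, (hw _ i).2 rfl⟩] at hs
    cases hs
  | some j =>
    have := (hw j i).1 (wins_of_slotOf_eq_some hs)
    rw [dif_pos (this ▸ j.2)]
    simp [this]

end Sorted

/-! ### Prices, envy-freeness and deviations -/

section Equilibrium

variable {S : Setting n k} {π : Equiv.Perm (Fin n)} {q : Fin n → ℝ}

theorem priceAt_of_sorted (hS : S.IsAdmissible) (h : IsPriceEq S.rate S.value S.budget π q)
    {β : Fin n → Bid} (hoff : ∀ i j, offer (β i) (S.ctr j) = rankBid q (π i) / S.ctr j)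
    (hord : ∀ x y, π x < π y → rankBid q (π y) < rankBid q (π x) ∨
      (rankBid q (π y) = rankBid q (π x) ∧ S.tie x < S.tie y)) {j : Fin k} {i : Fin n}
    (hi : (π i : ℕ) = j) : priceAt S β j i = q (π i) / S.ctr j := by
  have hq : Antitone q :=
    fun s t hst => h.isApproxEq.price_mono hS.value_nonneg (hS.rate_antitone hst)
  have hU := unassigned_of_sorted hS hoff hord j.2.le
  have hπ : π i = ⟨j, j.2.trans_le hS.slots_le_players⟩ := Fin.ext hi
  by_cases hlast : (j : ℕ) + 1 < n
  · have hnext : π.symm ⟨j + 1, hlast⟩ ≠ i := by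
      intro e
      rw [← e, Equiv.apply_symm_apply] at hi
      simp at hi
    refine le_antisymm ?_ ?_
    · rw [priceAt]
      split_ifs with hne
      · refine Finset.sup'_le _ _ fun i' hi' => ?_
        rw [hU, Finset.mem_erase, Finset.mem_filter] at hi'
        have h1 : (π i' : ℕ) ≠ j := fun e => hi'.1 (π.injective (Fin.ext (e.trans hi.symm)))
        have h2 : (⟨j + 1, hlast⟩ : Fin n) ≤ π i' :=
          Fin.le_def.2 (by have := hi'.2.2; dsimp only; omega)
        rw [hoff, hπ, ← rankBid_succ q hlast]
        exact div_le_div_of_nonneg_right (rankBid_antitone hq h2) (hS.ctr_pos j).le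
      · exact div_nonneg (h.nonneg _) (hS.ctr_pos j).le
    · have := le_priceAt (S := S) (β := β) (j := j) hnext (by rw [hU]; simp)
      rwa [hoff, Equiv.apply_symm_apply, rankBid_succ q hlast, ← hπ] at this
  -- The slot of the last player, with no competitor left: the mechanism's default price zero agrees
  -- with the lowest equilibrium price.
  · have hq0 : q (π i) = 0 := h.price_eq_zero hS.value_nonneg fun s =>
      hS.rate_antitone (Fin.le_def.2 (by have := s.2; omega))
    rw [hq0, zero_div, priceAt, dif_neg]
    rintro ⟨i', hi'⟩
    rw [hU, Finset.mem_erase, Finset.mem_filter] at hi'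
    exact hi'.1 (π.injective (Fin.ext (by have := hi'.2.2; have := (π i').2; omega)))

theorem rate_apply {j : Fin k} {t : Fin n} (ht : (t : ℕ) = j) : S.rate t = S.ctr j := by
  have : (t : ℕ) < k := ht ▸ j.2
  rw [Setting.rate, dif_pos this]
  congr 1
  exact Fin.ext ht

theorem utility_of_sorted (hS : S.IsAdmissible) (h : IsPriceEq S.rate S.value S.budget π q)
    {β : Fin n → Bid} (hoff : ∀ i j, offer (β i) (S.ctr j) = rankBid q (π i) / S.ctr j)
    (hord : ∀ x y, π x < π y → rankBid q (π y) < rankBid q (π x) ∨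
      (rankBid q (π y) = rankBid q (π x) ∧ S.tie x < S.tie y)) (i : Fin n) :
    utility S (outcome S β) i =
      ((S.rate (π i) * S.value i - q (π i) : ℝ) : EReal) := by
  have hslot := slotOf_of_sorted hS hoff hord i
  by_cases hik : (π i : ℕ) < k
  · rw [dif_pos hik] at hslot
    have hc := hS.ctr_pos ⟨π i, hik⟩
    rw [utility_outcome_of_some hslot, priceAt_of_sorted hS h hoff hord rfl,
      mul_div_cancel₀ _ hc.ne', if_pos (h.afford i),
      rate_apply (t := π i) (j := ⟨π i, hik⟩) rfl, mul_sub,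
      mul_div_cancel₀ _ hc.ne']
  · rw [dif_neg hik] at hslot
    have h0 : S.rate (π i) = 0 := S.rate_eq_zero (not_lt.1 hik)
    rw [utility_outcome_of_none hslot, h0, h.price_eq_zero hS.value_nonneg fun s =>
      h0 ▸ hS.rate_nonneg s]
    simp

theorem isEnvyFree_of_sorted (hS : S.IsAdmissible) (h : IsPriceEq S.rate S.value S.budget π q)
    {β : Fin n → Bid} (hoff : ∀ i j, offer (β i) (S.ctr j) = rankBid q (π i) / S.ctr j)
    (hord : ∀ x y, π x < π y → rankBid q (π y) < rankBid q (π x) ∨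
      (rankBid q (π y) = rankBid q (π x) ∧ S.tie x < S.tie y)) :
    IsEnvyFree S (outcome S β) := by
  have hslot := slotOf_of_sorted hS hoff hord
  have hrank : ∀ i j, slotOf S β i = some j → (π i : ℕ) = j := fun i j hij =>
    (wins_iff_of_sorted hS hoff hord j i).1 (wins_of_slotOf_eq_some hij)
  refine ⟨fun i i' j hi hi' => ?_, fun j => ?_, fun i i' j hi' => ?_⟩
  · exact π.injective (Fin.ext ((hrank i j hi).trans (hrank i' j hi').symm))
  · refine ⟨π.symm ⟨j, j.2.trans_le hS.slots_le_players⟩, ?_⟩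
    change slotOf S β _ = _
    rw [hslot, dif_pos (by simp)]
    simp
  · have hu := h.utility_nonneg hS.rate_nonneg hS.value_nonneg hS.budget_nonneg i
    have hj := hrank i' j hi'
    have hc := hS.ctr_pos j
    rw [utility_of_sorted hS h hoff hord, price_outcome_of_some hi',
      priceAt_of_sorted hS h hoff hord hj, mul_div_cancel₀ _ hc.ne', mul_sub,
      mul_div_cancel₀ _ hc.ne']
    split_ifs with hb
    · have := h.no_envy i (π i') hb
      rw [rate_apply hj] at this
      exact EReal.coe_le_coe_iff.2 (max_le this hu)
    · exact_mod_cast hu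

/-- A deviation may reshuffle the slots above `j`, but cannot remove all the competitors whose bids
keep the price of `j` at or above its equilibrium level. -/
theorem isNash_of_sorted (hS : S.IsAdmissible) (h : IsPriceEq S.rate S.value S.budget π q)
    {β : Fin n → Bid} (hoff : ∀ i j, offer (β i) (S.ctr j) = rankBid q (π i) / S.ctr j)
    (hord : ∀ x y, π x < π y → rankBid q (π y) < rankBid q (π x) ∨
      (rankBid q (π y) = rankBid q (π x) ∧ S.tie x < S.tie y)) : IsNash S β := by
  classical
  have hq : Antitone q :=
    fun s t hst => h.isApproxEq.price_mono hS.value_nonneg (hS.rate_antitone hst)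
  intro i b
  have hu := h.utility_nonneg hS.rate_nonneg hS.value_nonneg hS.budget_nonneg i
  rw [utility_of_sorted hS h hoff hord]
  set β' := Function.update β i b with hβ'
  cases hs : slotOf S β' i with
  | none =>
    rw [utility_outcome_of_none hs]
    exact_mod_cast hu
  | some j =>
    rw [utility_outcome_of_some hs]
    split_ifs with hb
    swap
    · exact bot_le
    have hc := hS.ctr_pos j
    have hkn := hS.slots_le_players
    have hjk := j.2
    set J : Fin n := ⟨j, hjk.trans_le hkn⟩ with hJ
    have hprice : q J ≤ S.ctr j * priceAt S β' j i := by
      by_cases hlast : (j : ℕ) + 1 < n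
      · set U := unassigned S β' j
        -- The `j + 2` players of rank at most `j + 1` bid at least `q J`. Apart from `i`, at least
        -- `j + 1` of them and at least `n - j - 1` unassigned players lie among `n - 1`, so the two
        -- groups meet.
        set G : Finset (Fin n) := (Finset.Iic ⟨j + 1, hlast⟩).map π.symm.toEmbedding with hG
        have hU : U.card = n - j := card_unassigned S β' hkn hjk.le
        have hGc : G.card = j + 2 := by rw [hG, Finset.card_map, Fin.card_Iic]
        have h1 := Finset.pred_card_le_card_erase (s := U) (a := i)
        have h2 := Finset.pred_card_le_card_erase (s := G) (a := i)
        have h3 : (Finset.univ.erase i).card = n - 1 := by simp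
        obtain ⟨i', hi'⟩ := Finset.inter_nonempty_of_card_lt_card_add_card
          (Finset.erase_subset_erase i (Finset.subset_univ U))
          (Finset.erase_subset_erase i (Finset.subset_univ G)) (by omega)
        rw [Finset.mem_inter, Finset.mem_erase, Finset.mem_erase] at hi'
        obtain ⟨⟨hne, hiU⟩, _, hiG⟩ := hi'
        have hle : π i' ≤ ⟨j + 1, hlast⟩ := by
          obtain ⟨t, ht, rfl⟩ := Finset.mem_map.1 hiG
          simpa using ht
        have h4 := le_priceAt (S := S) (β := β') (j := j) hne hiU
        rw [hβ', Function.update_of_ne hne, hoff, div_le_iff₀ hc, mul_comm] at h4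
        have h5 := rankBid_antitone hq hle
        rw [rankBid_succ] at h5
        exact h5.trans h4
      · have hq0 : q J = 0 := h.price_eq_zero hS.value_nonneg fun s =>
          hS.rate_antitone (Fin.le_def.2 (by have := s.2; simp only [hJ]; omega))
        rw [hq0]
        exact mul_nonneg hc.le (priceAt_nonneg hS _ _ _)
    have h6 := h.no_envy i J (hprice.trans hb)
    rw [rate_apply (t := J) (j := j) rfl] at h6
    refine EReal.coe_le_coe_iff.2 ?_
    rw [mul_sub]
    linarith

end Equilibrium

end BudgetAuction

theorem mainTheorem5 {n k : ℕ} (S : BudgetAuction.Setting n k) (hS : S.IsAdmissible) :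
    ∃ β : Fin n → BudgetAuction.Bid,
      BudgetAuction.IsNash S β ∧ BudgetAuction.IsEnvyFree S (BudgetAuction.outcome S β) := by
  rcases Nat.eq_zero_or_pos n with rfl | hn
  · have hk : k = 0 := Nat.le_zero.1 hS.slots_le_players
    subst hk
    exact ⟨fun i => i.elim0, fun i => i.elim0, fun i => i.elim0, fun j => j.elim0,
      fun i => i.elim0⟩
  · have : NeZero n := ⟨hn.ne'⟩
    obtain ⟨π, q, h, hord⟩ := BudgetAuction.exists_sorted_isPriceEq S hS
    have hoff : ∀ i j, BudgetAuction.offer (S.budgetBid hS (BudgetAuction.rankBid q (π i))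
        (BudgetAuction.rankBid_nonneg h.nonneg _)) (S.ctr j) =
        BudgetAuction.rankBid q (π i) / S.ctr j :=
      fun i j => BudgetAuction.offer_budgetBid hS _ j
    exact ⟨_, BudgetAuction.isNash_of_sorted hS h hoff hord,
      BudgetAuction.isEnvyFree_of_sorted hS h hoff hord⟩
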